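/- Let $\mathcal H=\bigoplus_{x\in\mathbb Z}\mathcal H_x$ be a complex Hilbert space, orthogonally decomposed into cells $\mathcal H_x$ of finite, non-zero dimension. For $a\in\mathbb Z$ let $P_{\ge a}$ be the orthogonal projection onto $\bigoplus_{x\ge a}\mathcal H_x$, and put $P=P_{\ge 0}$. Let $W$ be a unitary operator on $\mathcal H$ that is essentially local, i.e. $P_{\ge a}-W^*P_{\ge a}W$ is compact for some $a\in\mathbb Z$. Then $PWP$, regarded as an operator on the half-space $P\mathcal H$, is a Fredholm operator, so that $$\mathrm{ind}(W):=\mathrm{ind}_{\mathrm F}(PWP)=\dim\ker(PWP)-\dim\ker\big((PWP)^*\big)\in\mathbb Z$$ (kernels taken in $P\mathcal H$) is well defined. Let the essential spectrum $\sigma_{\mathrm{ess}}(W)$ be the set of all $z\in\mathbb C$ such that the spectral projection of $W$ for every neighbourhood of $z$ has infinite-dimensional range. Then: 1. If $\mathrm{ind}(W)\neq 0$, then $\sigma_{\mathrm{ess}}(W)$ is the whole unit circle $\{z\in\mathbb C:|z|=1\}$. 2. Consequently, if $W$ is essentially gapped, i.e. $1\notin\sigma_{\mathrm{ess}}(W)$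 and $-1\notin\sigma_{\mathrm{ess}}(W)$, then $\mathrm{ind}(W)=0$. -/

import Mathlib

noncomputable section

namespace QWalk

/-- A cell structure: an orthogonal Hilbert space decomposition `H = ⨁_{x ∈ ℤ} H_x` into cells of
finite, non-vanishing dimension. -/
structure CellStructure (H : Type*) [NormedAddCommGroup H] [InnerProductSpace ℂ H]
    [CompleteSpace H] where
  /-- The cell `H_x` at the position `x`. -/
  cell : ℤ → Submodule ℂ H
  finiteDimensional_cell : ∀ x, FiniteDimensional ℂ (cell x)
  cell_ne_bot : ∀ x, cell x ≠ ⊥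
  isHilbertSum : IsHilbertSum ℂ (fun x => cell x) (fun x => (cell x).subtypeₗᵢ)

section

variable {H : Type*} [NormedAddCommGroup H] [InnerProductSpace ℂ H] [CompleteSpace H]

/-- The right half-space `⨁_{x ≥ a} H_x`: the closed span of the cells at positions `x ≥ a`. -/
def CellStructure.halfSpace (C : CellStructure H) (a : ℤ) : Submodule ℂ H :=
  (⨆ x : {x : ℤ // a ≤ x}, C.cell x).topologicalClosure

instance (C : CellStructure H) (a : ℤ) : CompleteSpace (C.halfSpace a) :=
  inferInstanceAs
    (CompleteSpace (⨆ x : {x : ℤ // a ≤ x}, C.cell x).topologicalClosure)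

/-- The orthogonal projection `P_{≥ a}` of `H` onto the half-space of the cells at `x ≥ a`. -/
def CellStructure.proj (C : CellStructure H) (a : ℤ) : H →L[ℂ] H :=
  (C.halfSpace a).starProjection

/-- `W` is essentially local: `P_{≥ a} - W* P_{≥ a} W` is a compact operator for some `a`. -/
def IsEssentiallyLocal (C : CellStructure H) (W : H →L[ℂ] H) : Prop :=
  ∃ a : ℤ, IsCompactOperator (C.proj a - star W * C.proj a * W)

/-- The compression `P W P` with `P = P_{≥ 0}`, as an operator on the half-space `P H`. -/
def compression (C : CellStructure H) (W : H →L[ℂ] H) : C.halfSpace 0 →L[ℂ] C.halfSpace 0 :=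
  (C.halfSpace 0).orthogonalProjectionOnto ∘L W ∘L (C.halfSpace 0).subtypeL

/-- The Fredholm index `dim ker T - dim ker T*` of a Fredholm operator `T` on a Hilbert space. -/
def fredholmIndex (T : H →L[ℂ] H) : ℤ :=
  (Module.finrank ℂ (LinearMap.ker T.toLinearMap) : ℤ) -
    (Module.finrank ℂ (LinearMap.ker (ContinuousLinearMap.adjoint T).toLinearMap) : ℤ)

/-- The half-space index `ind(W) = ind_F(P W P)`. -/
def halfSpaceIndex (C : CellStructure H) (W : H →L[ℂ] H) : ℤ :=
  fredholmIndex (compression C W)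

/-- The range of the spectral projection `E(U)` of a normal operator `W` for an open set `U`.
The indicator function of `U` is the pointwise supremum of the continuous functions
`0 ≤ f ≤ 1` vanishing outside `U`, so `E(U)` is the supremum of the corresponding operators `f(W)`,
and its range is the closed span of the ranges of all `f(W)` with `f` continuous
and vanishing outside `U`. -/
def spectralSubspace (W : H →L[ℂ] H) (U : Set ℂ) : Submodule ℂ H :=
  (⨆ f : {f : ℂ → ℂ // Continuous f ∧ ∀ z, z ∉ U → f z = 0},
    LinearMap.range (cfc f.1 W).toLinearMap).topologicalClosure

/-- The essential spectrum of a normal operator: the complex numbers all of whose (open)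
neighbourhoods have an infinite dimensional spectral projection. -/
def essentialSpectrum (W : H →L[ℂ] H) : Set ℂ :=
  {z | ∀ U : Set ℂ, IsOpen U → z ∈ U → ¬ FiniteDimensional ℂ (spectralSubspace W U)}

/-- `W` is essentially gapped: it has an essential gap at each of the points `1` and `-1`. -/
def IsEssentiallyGapped (W : H →L[ℂ] H) : Prop :=
  (1 : ℂ) ∉ essentialSpectrum W ∧ (-1 : ℂ) ∉ essentialSpectrum W

end

end QWalk

end

open ContinuousLinearMap

namespace QWalk

/-! ### Compact perturbations of invertible operators, and their index. -/

section CompactPerturbation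

variable {E : Type*} [NormedAddCommGroup E] [InnerProductSpace ℂ E]

/-! Essential locality makes `[W, P]` compact, so the compressions of `W` and `W*` to the half-space
are inverse to each other modulo compacts; hence the Fredholm property.

For the index, a point of the circle missing from the essential spectrum yields a point missing from
the spectrum: otherwise a bump function `f` near that point would give a finite rank `f(W)` whose
spectrum, the image of the whole circle, is infinite. After a rotation `1 + W` is invertible.
Unitarity gives `(1 + W)(1 + W)* = (1 + W) + (1 + W)*`, so `1 + W` has coercive real part and its
compression `U` is invertible. Modulo compacts, `PWP U* = PWP + 1 = U`, so `PWP` is invertible plus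
compact (`isUnitAddCompact_compress_of_isUnit_one_add`) and has index zero by the Fredholm
alternative. -/

theorem isCompactOperator_of_range_le {G : Type*} [NormedAddCommGroup G] [NormedSpace ℂ G]
    (T : E →L[ℂ] G) (F : Submodule ℂ G) [FiniteDimensional ℂ F] (h : ∀ x, T x ∈ F) :
    IsCompactOperator T := by
  have := FiniteDimensional.proper ℂ F
  exact (isCompactOperator_of_locallyCompactSpace_dom (T.codRestrict F h)).clm_comp F.subtypeL

theorem isCompactOperator_mul (A : E →L[ℂ] E) {K : E →L[ℂ] E} (hK : IsCompactOperator K) :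
    IsCompactOperator (A * K : E →L[ℂ] E) :=
  hK.clm_comp A

theorem isCompactOperator_starProjection (F : Submodule ℂ E) [FiniteDimensional ℂ F] :
    IsCompactOperator F.starProjection :=
  isCompactOperator_of_range_le _ F fun x => F.starProjection_apply_mem x

/-- A compact operator into a Hilbert space is a norm limit of finite rank operators. -/
theorem exists_norm_sub_starProjection_comp_lt {K : E →L[ℂ] E} (hK : IsCompactOperator K)
    {ε : ℝ} (hε : 0 < ε) :
    ∃ (F : Submodule ℂ E) (_ : FiniteDimensional ℂ F), ‖K - F.starProjection * K‖ < ε := by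
  obtain ⟨Z, hZ, hKZ⟩ := hK.image_closedBall_subset_compact (𝕜₁ := ℂ) (f := (K : E →ₗ[ℂ] E)) 1
  obtain ⟨t, -, ht, htZ⟩ := Metric.finite_approx_of_totallyBounded hZ.totallyBounded (ε / 2)
    (half_pos hε)
  have : FiniteDimensional ℂ (Submodule.span ℂ t) := FiniteDimensional.span_of_finite ℂ ht
  refine ⟨Submodule.span ℂ t, this, lt_of_le_of_lt ?_ (half_lt_self hε)⟩
  refine opNorm_le_of_unit_norm (half_pos hε).le fun x hx => ?_
  obtain ⟨y, hy, hxy⟩ := Set.mem_iUnion₂.1 (htZ (hKZ ⟨x, by simp [hx], rfl⟩))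
  have h := (Submodule.span ℂ t).starProjection_minimal (K x)
  calc ‖(K - (Submodule.span ℂ t).starProjection * K) x‖
      = ⨅ w : Submodule.span ℂ t, ‖K x - w‖ := h
    _ ≤ ‖K x - y‖ := ciInf_le ⟨0, by rintro _ ⟨w, rfl⟩; positivity⟩
        (⟨y, Submodule.subset_span hy⟩ : Submodule.span ℂ t)
    _ ≤ ε / 2 := by simpa [dist_eq_norm] using (Metric.mem_ball.1 hxy).le

/-- Compact perturbations of invertible operators. -/
def IsUnitAddCompact (T : E →L[ℂ] E) : Prop :=
  ∃ A K : E →L[ℂ] E, IsUnit A ∧ IsCompactOperator K ∧ T = A + K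

theorem isUnitAddCompact_one_sub {K : E →L[ℂ] E} (hK : IsCompactOperator K) :
    IsUnitAddCompact (1 - K) :=
  ⟨1, -K, isUnit_one, hK.neg, sub_eq_add_neg _ _⟩

namespace IsUnitAddCompact

variable {T : E →L[ℂ] E}

theorem add_compact (hT : IsUnitAddCompact T) {K : E →L[ℂ] E} (hK : IsCompactOperator K) :
    IsUnitAddCompact (T + K) := by
  obtain ⟨A, K', hA, hK', rfl⟩ := hT
  exact ⟨A, K' + K, hA, hK'.add hK, add_assoc _ _ _⟩

theorem mul_isUnit (hT : IsUnitAddCompact T) {A : E →L[ℂ] E} (hA : IsUnit A) :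
    IsUnitAddCompact (T * A) := by
  obtain ⟨B, K, hB, hK, rfl⟩ := hT
  exact ⟨B * A, K * A, hB.mul hA, hK.comp_clm A, add_mul _ _ _⟩

theorem smul (hT : IsUnitAddCompact T) {c : ℂ} (hc : c ≠ 0) : IsUnitAddCompact (c • T) := by
  obtain ⟨B, K, hB, hK, rfl⟩ := hT
  exact ⟨c • B, c • K, hB.smul (Units.mk0 c hc), hK.smul c, smul_add _ _ _⟩

end IsUnitAddCompact

variable [CompleteSpace E]

/-- Finite rank approximants of `K` have compact adjoints, and compact operators are norm closed. -/
theorem IsCompactOperator.star {K : E →L[ℂ] E} (hK : IsCompactOperator K) :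
    IsCompactOperator (star K : E →L[ℂ] E) := by
  have hcl := isClosed_setOfPred_isCompactOperator (σ₁₂ := RingHom.id ℂ) (M₁ := E) (M₂ := E)
  refine hcl.closure_subset (Metric.mem_closure_iff.2 fun ε hε => ?_)
  obtain ⟨F, _, hF⟩ := exists_norm_sub_starProjection_comp_lt hK hε
  refine ⟨Star.star (F.starProjection * K), ?_, ?_⟩
  · rw [star_mul, show Star.star F.starProjection = F.starProjection from
      (isSelfAdjoint_starProjection F)]
    exact (isCompactOperator_starProjection F).clm_comp (Star.star K)
  · rwa [dist_eq_norm, ← star_sub, norm_star]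

namespace IsUnitAddCompact

variable {T : E →L[ℂ] E}

theorem star (hT : IsUnitAddCompact T) : IsUnitAddCompact (star T) := by
  obtain ⟨A, K, hA, hK, rfl⟩ := hT
  exact ⟨_, _, hA.star, IsCompactOperator.star hK, star_add _ _⟩

theorem exists_isQuasiInverse (hT : IsUnitAddCompact T) :
    ∃ S : E →L[ℂ] E, S.IsQuasiInverse T := by
  obtain ⟨A, K, hA, hK, rfl⟩ := hT
  obtain ⟨ε, hε, hball⟩ := Metric.isOpen_iff.1 (Units.isOpen (R := E →L[ℂ] E)) A hA
  obtain ⟨F, hF, hKF⟩ := exists_norm_sub_starProjection_comp_lt hK hε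
  -- Invertibles are open, so the small part of `K` is absorbed into `A`; only a finite rank
  -- perturbation remains.
  obtain ⟨u, hu⟩ : IsUnit (A + (K - F.starProjection * K)) :=
    hball (by simpa [dist_eq_norm] using hKF)
  have hT : A + K = u + F.starProjection * K := by rw [hu]; abel
  have hfin : LinearMap.HasNoetherianRange
      (F.starProjection * K : E →L[ℂ] E).toLinearMap := by
    refine isNoetherian_of_le (t := F) ?_
    rintro _ ⟨x, rfl⟩
    exact F.starProjection_apply_mem _
  refine ⟨(↑u⁻¹ : E →L[ℂ] E), ?_, ?_⟩
  · refine (LinearMap.FiniteRangeSetoid.equiv_iff_hasNoetherianRange).2 ?_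
    have : (↑u⁻¹ : E →L[ℂ] E).toLinearMap ∘ₗ (A + K).toLinearMap - LinearMap.id =
        (↑u⁻¹ : E →L[ℂ] E).toLinearMap ∘ₗ (F.starProjection * K : E →L[ℂ] E).toLinearMap := by
      rw [hT]
      ext x
      have h : (↑u⁻¹ : E →L[ℂ] E) ((u : E →L[ℂ] E) x) = x := congr($(u.inv_mul) x)
      simp [h]
    rw [this]
    exact hfin.comp_left _
  · refine (LinearMap.FiniteRangeSetoid.equiv_iff_hasNoetherianRange).2 ?_
    have : (A + K).toLinearMap ∘ₗ (↑u⁻¹ : E →L[ℂ] E).toLinearMap - LinearMap.id =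
        (F.starProjection * K : E →L[ℂ] E).toLinearMap ∘ₗ (↑u⁻¹ : E →L[ℂ] E).toLinearMap := by
      rw [hT]
      ext x
      have h : (u : E →L[ℂ] E) ((↑u⁻¹ : E →L[ℂ] E) x) = x := congr($(u.mul_inv) x)
      simp [h]
    rw [this]
    exact hfin.comp_right _

theorem isFredholm (hT : IsUnitAddCompact T) : T.IsFredholm :=
  let ⟨_, hS⟩ := hT.exists_isQuasiInverse
  .of_isQuasiInverse hS

/-- The Fredholm alternative. -/
theorem isUnit_of_injective (hT : IsUnitAddCompact T) (hinj : Function.Injective T) :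
    IsUnit T := by
  obtain ⟨_, K, ⟨u, rfl⟩, hK, rfl⟩ := hT
  set L : E →L[ℂ] E := ↑u⁻¹ * K
  have hL : (u : E →L[ℂ] E) + K = u * (1 + L) := by simp [L, mul_add]
  have hLc : IsCompactOperator L := hK.clm_comp (↑u⁻¹ : E →L[ℂ] E)
  rcases hLc.hasEigenvalue_or_mem_resolventSet (μ := (-1 : ℂ)) (by simp) with h | h
  · obtain ⟨x, hx⟩ := h.exists_hasEigenvector
    refine absurd (hinj (a₁ := x) (a₂ := 0) ?_) hx.2
    have : L x = -x := by simpa using hx.apply_eq_smul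
    rw [hL]
    simp [this]
  · rw [hL]
    refine u.isUnit.mul ?_
    rw [spectrum.mem_resolventSet_iff] at h
    convert h.neg using 1
    simp [add_comm]

/-- If `ker T*` were larger, a non-surjective injection `φ : ker T → ker T*` would exist. Adding `φ`
composed with the projection onto `ker T` makes `T` injective, hence invertible by the Fredholm
alternative, which forces `φ` to be onto. -/
theorem finrank_ker_star_le (hT : IsUnitAddCompact T) :
    Module.finrank ℂ (LinearMap.ker (ContinuousLinearMap.adjoint T).toLinearMap) ≤
      Module.finrank ℂ (LinearMap.ker T.toLinearMap) := by
  set N := LinearMap.ker T.toLinearMap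
  set M := LinearMap.ker (ContinuousLinearMap.adjoint T).toLinearMap
  have : FiniteDimensional ℂ N := hT.isFredholm.finite_ker
  have : FiniteDimensional ℂ M := hT.star.isFredholm.finite_ker
  by_contra! hlt
  obtain ⟨φ, hφ⟩ := finrank_le_iff_exists_linearMap.1 hlt.le
  -- The range of `T` is orthogonal to `ker T*`.
  have hM : ∀ m ∈ M, ∀ x, T x = m → m = 0 := by
    rintro _ hm x rfl
    have h0 : (ContinuousLinearMap.adjoint T) (T x) = 0 := hm
    rw [← inner_self_eq_zero (𝕜 := ℂ), ← ContinuousLinearMap.adjoint_inner_left, h0,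
      inner_zero_left]
  set G : E →L[ℂ] E := M.subtypeL ∘L (LinearMap.toContinuousLinearMap φ) ∘L
    N.orthogonalProjectionOnto
  have hG : ∀ x, G x = φ (N.orthogonalProjectionOnto x) := fun x => rfl
  have hTG : IsUnitAddCompact (T + G) :=
    hT.add_compact (isCompactOperator_of_range_le G M fun x => (φ _).2)
  have hunit : IsUnit (T + G) := by
    refine hTG.isUnit_of_injective ((injective_iff_map_eq_zero _).2 fun x hx => ?_)
    have hx' : T x = -G x := eq_neg_of_add_eq_zero_left hx
    have hG0 : G x = 0 := by
      rw [← neg_eq_zero]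
      exact hM _ (M.neg_mem (φ _).2) x hx'
    have hxN : x ∈ N := by simpa [N, hG0] using hx'
    have h0 : N.orthogonalProjectionOnto x = 0 := hφ (by
      rw [map_zero]; exact Subtype.ext hG0)
    have h1 := N.orthogonalProjectionOnto_mem_subspace_eq_self ⟨x, hxN⟩
    simpa [h0] using congr(($h1 : E)).symm
  have hsurj : Function.Surjective φ := by
    intro m
    obtain ⟨x, hx⟩ := (isUnit_iff_bijective.1 hunit).2 (m : E)
    have hx' : T x = ((m - φ (N.orthogonalProjectionOnto x) : M) : E) :=
      eq_sub_of_add_eq hx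
    have := hM _ (Subtype.property _) x hx'
    exact ⟨_, (sub_eq_zero.1 (Subtype.ext this)).symm⟩
  exact absurd (LinearMap.finrank_le_finrank_of_surjective hsurj) hlt.not_ge

/-- Compact perturbations of invertible operators have index zero. -/
theorem fredholmIndex_eq_zero (hT : IsUnitAddCompact T) : fredholmIndex T = 0 := by
  have h1 := hT.finrank_ker_star_le
  have h2 := hT.star.finrank_ker_star_le
  rw [star_eq_adjoint, adjoint_adjoint] at h2
  rw [fredholmIndex, le_antisymm h1 h2, sub_self]

end IsUnitAddCompact

/-- An operator that is invertible modulo compact operators is Fredholm. -/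
theorem isFredholm_of_mul {S T : E →L[ℂ] E} (h₁ : IsUnitAddCompact (S * T))
    (h₂ : IsUnitAddCompact (T * S)) : T.IsFredholm := by
  obtain ⟨A, hA⟩ := h₁.exists_isQuasiInverse
  obtain ⟨B, hB⟩ := h₂.exists_isQuasiInverse
  refine .of_isQuasiInverse (v := A * S) ⟨hA.1, ?_⟩
  have hl : LinearMap.IsLeftQuasiInverse (A * S : E →L[ℂ] E).toLinearMap T.toLinearMap := hA.1
  have hr : LinearMap.IsLeftQuasiInverse T.toLinearMap (S * B : E →L[ℂ] E).toLinearMap := hB.2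
  -- Left and right inverses agree modulo finite rank: `AS ≈ AS(TSB) ≈ SB`.
  open LinearMap.FiniteRangeSetoid in
  exact LinearMap.IsRightQuasiInverse.congr hr (by
    calc (A * S : E →L[ℂ] E).toLinearMap
        = (A * S : E →L[ℂ] E).toLinearMap ∘ₗ .id := rfl
      _ ≈ (A * S : E →L[ℂ] E).toLinearMap ∘ₗ
          (T.toLinearMap ∘ₗ (S * B : E →L[ℂ] E).toLinearMap) := by
        grw [hr.equiv]
      _ = ((A * S : E →L[ℂ] E).toLinearMap ∘ₗ T.toLinearMap) ∘ₗ
          (S * B : E →L[ℂ] E).toLinearMap := rfl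
      _ ≈ .id ∘ₗ (S * B : E →L[ℂ] E).toLinearMap := by grw [hl.equiv]
      _ = _ := rfl) (Setoid.refl _)

end CompactPerturbation

end QWalk

namespace QWalk

/-! ### Compressions of unitaries that almost commute with the projection. -/

section Compress

variable {H : Type*} [NormedAddCommGroup H] [InnerProductSpace ℂ H]
  (E : Submodule ℂ H) [CompleteSpace E]

/-- The compression of an operator to a closed subspace. -/
noncomputable def compress (X : H →L[ℂ] H) : E →L[ℂ] E :=
  E.orthogonalProjectionOnto ∘L X ∘L E.subtypeL

theorem compress_smul (c : ℂ) (X : H →L[ℂ] H) : compress E (c • X) = c • compress E X := by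
  ext x
  simp [compress]

theorem compress_one_add (X : H →L[ℂ] H) : compress E (1 + X) = 1 + compress E X := by
  ext x
  simp [compress]

variable {E} in
theorem isCompactOperator_compress {X : H →L[ℂ] H} (hX : IsCompactOperator X) :
    IsCompactOperator (compress E X) :=
  (hX.comp_clm E.subtypeL).clm_comp E.orthogonalProjectionOnto

/-- The defect is `P X (1 - P) Y P`. Writing `(1 - P) Y P = (1 - P)[Y, P]` shows that it is compact
once `[Y, P]` is. -/
theorem compress_mul_compress (X Y : H →L[ℂ] H) :
    compress E X * compress E Y = compress E (X * Y) -
      compress E (X * (1 - E.starProjection) * (Y * E.starProjection - E.starProjection * Y)) := by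
  ext x
  have h : E.starProjection (E.starProjection (Y x)) = E.starProjection (Y x) :=
    E.starProjection_eq_self_iff.2 (E.starProjection_apply_mem _)
  simp [compress, h]

theorem isUnitAddCompact_compress_mul {X Y : H →L[ℂ] H} (hXY : X * Y = 1)
    (hY : IsCompactOperator (Y * E.starProjection - E.starProjection * Y)) :
    IsUnitAddCompact (compress E X * compress E Y) := by
  rw [compress_mul_compress, hXY, show compress E 1 = 1 by ext x; simp [compress]]
  exact isUnitAddCompact_one_sub (isCompactOperator_compress (isCompactOperator_mul _ hY))

variable [CompleteSpace H]

theorem star_compress (X : H →L[ℂ] H) : star (compress E X) = compress E (star X) := by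
  simp only [compress, star_eq_adjoint, adjoint_comp, Submodule.adjoint_subtypeL,
    Submodule.adjoint_orthogonalProjectionOnto]
  rfl

variable {E} {W : H →L[ℂ] H}

theorem isCompactOperator_commutator_star
    (hW : W ∈ unitary (H →L[ℂ] H))
    (hc : IsCompactOperator (W * E.starProjection - E.starProjection * W)) :
    IsCompactOperator (star W * E.starProjection - E.starProjection * star W) := by
  have h : star W * E.starProjection - E.starProjection * star W =
      -(star W * ((W * E.starProjection - E.starProjection * W) * star W)) := by
    have h1 : star W * W = 1 := hW.1
    have h2 : W * star W = 1 := hW.2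
    rw [sub_mul, mul_sub, ← mul_assoc, ← mul_assoc, h1, mul_assoc _ W, h2]
    simp
  rw [h]
  exact ((hc.comp_clm (star W)).clm_comp (star W)).neg

theorem isFredholm_compress (hW : W ∈ unitary (H →L[ℂ] H))
    (hc : IsCompactOperator (W * E.starProjection - E.starProjection * W)) :
    (compress E W).IsFredholm :=
  isFredholm_of_mul (isUnitAddCompact_compress_mul E hW.1 hc)
    (isUnitAddCompact_compress_mul E hW.2 (isCompactOperator_commutator_star hW hc))

/-- If `1 + W` is invertible with `W` unitary, then `1 + W` is coercive,
and so are its compressions. -/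
theorem isUnit_compress_one_add (hW : W ∈ unitary (H →L[ℂ] H)) (hu : IsUnit (1 + W)) :
    IsUnit (compress E (1 + W)) := by
  obtain ⟨u, hu'⟩ := hu.star
  obtain ⟨c, hc⟩ : ∃ c > 0, ∀ x, c * ‖x‖ ≤ ‖(star (1 + W)) x‖ := by
    -- The summand `1` keeps the constant positive when `H` is trivial.
    refine ⟨(‖(↑u⁻¹ : H →L[ℂ] H)‖ + 1)⁻¹, by positivity, fun x => ?_⟩
    rw [inv_mul_le_iff₀ (by positivity), ← hu']
    calc ‖x‖ = ‖(↑u⁻¹ : H →L[ℂ] H) ((u : H →L[ℂ] H) x)‖ := by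
          congr 1; exact congr($(u.inv_mul) x).symm
      _ ≤ _ := (le_opNorm _ _).trans (by gcongr; linarith)
  have hre : ∀ x, ‖(star (1 + W)) x‖ ^ 2 = 2 * (inner ℂ x ((1 + W) x)).re := by
    intro x
    have h1 : (1 + W) * star (1 + W) = (1 + W) + star (1 + W) := by
      have h2 : W * star W = 1 := hW.2
      simp only [star_add, star_one, add_mul, mul_add, h2, one_mul, mul_one]
      abel
    have h3 : inner ℂ ((star (1 + W)) x) ((star (1 + W)) x) =
        inner ℂ x ((1 + W) x) + inner ℂ x ((star (1 + W)) x) := by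
      rw [star_eq_adjoint, adjoint_inner_left, ← star_eq_adjoint, ← inner_add_right]
      exact congr(inner ℂ x ($h1 x))
    have h4 : inner ℂ x ((star (1 + W)) x) = inner ℂ ((1 + W) x) x := by
      rw [star_eq_adjoint, adjoint_inner_right]
    rw [← inner_self_eq_norm_sq (𝕜 := ℂ), h3, h4, RCLike.re_to_complex, Complex.add_re,
      ← inner_conj_symm ((1 + W) x) x, Complex.conj_re]
    ring
  obtain ⟨hc0, hc⟩ := hc
  -- By `hre` and `hc`, `Re ⟪x, (1 + W) x⟫ ≥ c² ‖x‖² / 2`. Compression to `E` preserves this form,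
  -- so Lax–Milgram applies.
  refine isUnit_of_forall_le_norm_inner_map _ (c := Real.toNNReal (c ^ 2 / 2))
    (Real.toNNReal_pos.2 (by positivity)) fun x => ?_
  have hin : inner ℂ (compress E (1 + W) x) x = inner ℂ ((1 + W) (x : H)) (x : H) := by
    simp only [compress, comp_apply]
    rw [← E.inner_orthogonalProjectionOnto_eq_of_mem_right]; rfl
  rw [hin, norm_inner_symm]
  refine le_trans ?_ ((le_abs_self _).trans (Complex.abs_re_le_norm _))
  have h1 := hre x
  have h2 := pow_le_pow_left₀ (by positivity) (hc x) 2
  rw [Real.coe_toNNReal _ (by positivity)]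
  rw [mul_pow] at h2
  have h3 : ‖(x : H)‖ = ‖x‖ := rfl
  rw [h3] at h2
  nlinarith

/-- With `U` the compression of `1 + W`, the product of the compression of `W` with `U*` is `U`
modulo compacts. Both `U` and `U*` are invertible, so `U*` can be divided out. -/
theorem isUnitAddCompact_compress_of_isUnit_one_add (hW : W ∈ unitary (H →L[ℂ] H))
    (hc : IsCompactOperator (W * E.starProjection - E.starProjection * W))
    (hu : IsUnit (1 + W)) : IsUnitAddCompact (compress E W) := by
  have hU := isUnit_compress_one_add (E := E) hW hu
  set U := compress E (1 + W)
  obtain ⟨v, hv⟩ := hU.star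
  have hprod : IsUnitAddCompact (compress E W * star U) := by
    have h := compress_mul_compress E W (star W)
    rw [show W * star W = 1 from hW.2, show compress E 1 = 1 by ext x; simp [compress]] at h
    have : compress E W * star U = U + -compress E (W * (1 - E.starProjection) *
        (star W * E.starProjection - E.starProjection * star W)) := by
      rw [star_compress, star_add, star_one, compress_one_add, mul_add, mul_one, h,
        show U = 1 + compress E W from compress_one_add E W]
      abel
    exact ⟨_, _, hU, (isCompactOperator_compress
      (isCompactOperator_mul _ (isCompactOperator_commutator_star hW hc))).neg, this⟩
  have h2 := hprod.mul_isUnit v⁻¹.isUnit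
  rwa [← hv, Units.mul_inv_cancel_right] at h2

theorem isUnitAddCompact_compress_of_notMem_spectrum (hW : W ∈ unitary (H →L[ℂ] H))
    (hc : IsCompactOperator (W * E.starProjection - E.starProjection * W))
    {z : ℂ} (hz : z ∈ Metric.sphere (0 : ℂ) 1) (hzW : z ∉ spectrum ℂ W) :
    IsUnitAddCompact (compress E W) := by
  have hz0 : z ≠ 0 := by rintro rfl; simp at hz
  have hzz : (starRingEnd ℂ) z * z = 1 := by
    rw [mul_comm, Complex.mul_conj, Complex.normSq_eq_norm_sq]; simp_all
  have hzz' : (-z) * (-(starRingEnd ℂ) z) = 1 := by rw [neg_mul_neg, mul_comm, hzz]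
  -- Multiplication by `c` rotates the gap point `z` to `-1`.
  set c : ℂ := -(starRingEnd ℂ) z
  have hc0 : c ≠ 0 := right_ne_zero_of_mul_eq_one hzz'
  have hcs : star c * c = 1 := by simpa [c] using hzz'
  have hcW : c • W ∈ unitary (H →L[ℂ] H) := by
    constructor
    · rw [star_smul, smul_mul_smul_comm, hcs, hW.1, one_smul]
    · rw [star_smul, smul_mul_smul_comm, mul_comm c, hcs, hW.2, one_smul]
  have hcc : IsCompactOperator ((c • W) * E.starProjection - E.starProjection * (c • W)) := by
    rw [smul_mul_assoc, mul_smul_comm, ← smul_sub]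
    exact hc.smul c
  have hu : IsUnit (1 + c • W) := by
    have h1 : 1 + c • W = -c • (algebraMap ℂ (H →L[ℂ] H) z - W) := by
      rw [smul_sub, Algebra.algebraMap_eq_smul_one, smul_smul]
      simp [c, hzz, sub_eq_add_neg]
    rw [h1]
    exact (spectrum.notMem_iff.1 hzW).smul (Units.mk0 (-c) (neg_ne_zero.2 hc0))
  have h := (isUnitAddCompact_compress_of_isUnit_one_add hcW hcc hu).smul (inv_ne_zero hc0)
  rwa [compress_smul, inv_smul_smul₀ hc0] at h

end Compress

/-! ### Half-space projections and essential locality. -/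

section HalfSpace

variable {H : Type*} [NormedAddCommGroup H] [InnerProductSpace ℂ H]

/-- If the projection of `x` onto `L` is `k + f`, its projection onto `K` is `k + P_K f`; the
difference lies in `(1 - P_K) F`. -/
theorem isCompactOperator_starProjection_sub (K L F : Submodule ℂ H) [CompleteSpace K]
    [CompleteSpace L] [FiniteDimensional ℂ F] (hKL : K ≤ L) (hLF : L ≤ K ⊔ F) :
    IsCompactOperator (L.starProjection - K.starProjection) := by
  refine isCompactOperator_of_range_le _ (F.map (1 - K.starProjection).toLinearMap) fun x => ?_
  obtain ⟨k, hk, f, hf, hkf⟩ := Submodule.mem_sup.1 (hLF (L.starProjection_apply_mem x))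
  refine ⟨f, hf, ?_⟩
  have h1 : K.starProjection (L.starProjection x) = K.starProjection x :=
    congr($(Submodule.starProjection_comp_starProjection_of_le hKL) x)
  have h2 : K.starProjection k = k := K.starProjection_eq_self_iff.2 hk
  rw [← hkf, map_add, h2] at h1
  simp [← hkf, ← h1]

variable [CompleteSpace H]

namespace CellStructure

variable (C : CellStructure H)

theorem isCompactOperator_proj_sub_of_le {a b : ℤ} (hab : a ≤ b) :
    IsCompactOperator (C.proj a - C.proj b) := by
  have := C.finiteDimensional_cell
  have hF : FiniteDimensional ℂ (⨆ x ∈ Finset.Ico a b, C.cell x : Submodule ℂ H) := by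
    rw [← Finset.sup_eq_iSup]
    exact Submodule.finiteDimensional_finset_sup _ _
  refine isCompactOperator_starProjection_sub (C.halfSpace b) (C.halfSpace a)
    (⨆ x ∈ Finset.Ico a b, C.cell x)
    (Submodule.topologicalClosure_mono (iSup_le fun x =>
      le_iSup (fun y : {y : ℤ // a ≤ y} => C.cell y) ⟨x, hab.trans x.2⟩)) ?_
  refine Submodule.topologicalClosure_minimal _ (iSup_le fun x => ?_)
    (Submodule.isClosed_sup_finiteDimensional _ _ (Submodule.isClosed_topologicalClosure _))
  rcases lt_or_ge x.1 b with hx | hx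
  · exact le_sup_of_le_right (le_iSup₂_of_le x.1 (Finset.mem_Ico.2 ⟨x.2, hx⟩) le_rfl)
  · exact le_sup_of_le_left ((le_iSup (fun y : {y : ℤ // b ≤ y} => C.cell y) ⟨x.1, hx⟩).trans
      (Submodule.le_topologicalClosure _))

theorem isCompactOperator_proj_sub (a b : ℤ) : IsCompactOperator (C.proj a - C.proj b) := by
  rcases le_total a b with h | h
  · exact C.isCompactOperator_proj_sub_of_le h
  · simpa using (C.isCompactOperator_proj_sub_of_le h).neg

end CellStructure

/-- At the cut `a` of the definition, `[W, P_a] = W (P_a - W* P_a W)`. Moving the cut changes the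
projection only by finitely many finite-dimensional cells. -/
theorem IsEssentiallyLocal.isCompactOperator_commutator {C : CellStructure H} {W : H →L[ℂ] H}
    (hloc : IsEssentiallyLocal C W) (hW : W ∈ unitary (H →L[ℂ] H)) (b : ℤ) :
    IsCompactOperator (W * C.proj b - C.proj b * W) := by
  obtain ⟨a, ha⟩ := hloc
  have h0 : IsCompactOperator (W * C.proj a - C.proj a * W) := by
    have h : W * C.proj a - C.proj a * W = W * (C.proj a - star W * C.proj a * W) := by
      rw [mul_sub, ← mul_assoc, ← mul_assoc, hW.2, one_mul]
    rw [h]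
    exact ha.clm_comp W
  have h1 := C.isCompactOperator_proj_sub b a
  have h : W * C.proj b - C.proj b * W = (W * C.proj a - C.proj a * W) +
      (W * (C.proj b - C.proj a) - (C.proj b - C.proj a) * W) := by noncomm_ring
  rw [h]
  exact h0.add ((h1.clm_comp W).sub (h1.comp_clm W))

end HalfSpace

/-! ### From an essential gap to a spectral gap. -/

section Spectrum

variable {H : Type*} [NormedAddCommGroup H] [InnerProductSpace ℂ H]

open Polynomial in
-- `T` is annihilated by `p * X`, with `p` the minimal polynomial of `T` on `F`: the factor `X`
-- first sends every vector into `F`.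
theorem finite_spectrum_of_range_le {T : H →L[ℂ] H} (F : Submodule ℂ H)
    [FiniteDimensional ℂ F] (h : ∀ x, T x ∈ F) : (spectrum ℂ T).Finite := by
  set t : Module.End ℂ F := T.toLinearMap.restrict fun x _ => h x
  set p := minpoly ℂ t
  have hp : p ≠ 0 := minpoly.ne_zero (Algebra.IsIntegral.isIntegral t)
  have hpow : ∀ q : ℂ[X], ∀ y : F, (aeval T q) (y : H) = ((aeval t q) y : F) := by
    intro q
    induction q using Polynomial.induction_on' with
    | add q r hq hr => intro y; simp [hq, hr]
    | monomial n c =>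
      intro y
      induction n generalizing y with
      | zero => simp [Algebra.algebraMap_eq_smul_one]
      | succ n ih =>
        have h1 := ih (t y)
        simp only [aeval_monomial, pow_succ] at h1 ⊢
        exact h1
  have hzero : aeval T (p * X) = 0 := by
    ext x
    have := hpow p ⟨T x, h x⟩
    rw [minpoly.aeval] at this
    simpa using this
  refine ((p * X).roots.toFinset.finite_toSet).subset fun z hz => ?_
  have hne : p * X ≠ 0 := mul_ne_zero hp X_ne_zero
  have hmem := spectrum.subset_polynomial_aeval T (p * X) ⟨z, hz, rfl⟩
  rw [hzero] at hmem
  have : Nontrivial (H →L[ℂ] H) := by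
    by_contra hn
    rw [not_nontrivial_iff_subsingleton] at hn
    rw [spectrum.of_subsingleton] at hmem
    exact hmem
  rw [spectrum.zero_eq] at hmem
  simpa [hne] using hmem

variable [CompleteSpace H] {W : H →L[ℂ] H}

/-- A function vanishing on the circle vanishes on the spectrum of `W`, so the spectral subspace of
the circle's complement is zero. -/
theorem essentialSpectrum_subset_sphere (hW : W ∈ unitary (H →L[ℂ] H)) :
    essentialSpectrum W ⊆ Metric.sphere (0 : ℂ) 1 := by
  intro z hz
  by_contra hzs
  refine hz (Metric.sphere (0 : ℂ) 1)ᶜ Metric.isClosed_sphere.isOpen_compl hzs ?_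
  have : spectralSubspace W (Metric.sphere (0 : ℂ) 1)ᶜ = ⊥ := by
    have h0 : ∀ f : {f : ℂ → ℂ // Continuous f ∧ ∀ z, z ∉ (Metric.sphere (0 : ℂ) 1)ᶜ → f z = 0},
        LinearMap.range (cfc f.1 W).toLinearMap = ⊥ := by
      intro f
      have : cfc f.1 W = cfc (fun _ => (0 : ℂ)) W := cfc_congr fun w hw =>
        f.2.2 w (not_not.2 (spectrum.subset_circle_of_unitary hW hw))
      rw [this, cfc_const_zero]
      simp
    rw [spectralSubspace, iSup_congr h0, iSup_bot]
    exact IsClosed.submodule_topologicalClosure_eq (by simp)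
  rw [this]
  infer_instance

/-- A unitary operator whose essential spectrum is not the whole circle has a spectral gap. -/
theorem exists_notMem_spectrum_of_notMem_essentialSpectrum (hW : W ∈ unitary (H →L[ℂ] H))
    {z : ℂ} (hz : z ∈ Metric.sphere (0 : ℂ) 1) (hzW : z ∉ essentialSpectrum W) :
    ∃ w ∈ Metric.sphere (0 : ℂ) 1, w ∉ spectrum ℂ W := by
  by_contra! hall
  simp only [essentialSpectrum, Set.mem_ofPred_eq, not_forall, not_not] at hzW
  obtain ⟨U, hU, hzU, hfin⟩ := hzW
  obtain ⟨r, hr, hrU⟩ := Metric.isOpen_iff.1 hU z hzU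
  -- The bump of radius `s ≤ r` lives in `U`; `s ≤ 1` keeps it away from `-z`, at distance `2`.
  set s := min r 1
  have hs : 0 < s := lt_min hr one_pos
  set f : ℂ → ℂ := fun w => ((max 0 (s - dist w z) : ℝ) : ℂ)
  have hf : Continuous f := by fun_prop
  have hf0 : ∀ w, s ≤ dist w z → f w = 0 := fun w hw => by
    simp [f, max_eq_left (sub_nonpos.2 hw)]
  have hfU : ∀ w, w ∉ U → f w = 0 := fun w hw => hf0 w (by
    by_contra! hlt
    exact hw (hrU (hlt.trans_le (min_le_left _ _))))
  have hspec : (spectrum ℂ (cfc f W)).Finite :=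
    finite_spectrum_of_range_le (spectralSubspace W U) fun x =>
      Submodule.le_topologicalClosure _ (Submodule.mem_iSup_of_mem
        (p := fun g : {g : ℂ → ℂ // Continuous g ∧ ∀ z, z ∉ U → g z = 0} =>
          LinearMap.range (cfc g.1 W).toLinearMap) ⟨f, hf, hfU⟩ ⟨x, rfl⟩)
  have hnormal : IsStarNormal W := ⟨hW.1.trans hW.2.symm⟩
  rw [cfc_map_spectrum f W] at hspec
  have hconn : IsPreconnected (f '' Metric.sphere (0 : ℂ) 1) :=
    (isPreconnected_sphere (by rw [Complex.rank_real_complex]; simp) 0 1).image f hf.continuousOn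
  -- The image of the circle is connected and contains `f z = s` and `f (-z) = 0`, so it is
  -- infinite.
  refine hconn.infinite_of_nontrivial ⟨f z, ⟨z, hz, rfl⟩, f (-z), ⟨-z, by simpa using hz, rfl⟩, ?_⟩
    (hspec.subset (Set.image_mono hall))
  have hz1 : ‖z‖ = 1 := by simpa using hz
  rw [hf0 (-z)]
  · have : f z = (s : ℂ) := by simp [f, max_eq_right hs.le]
    rw [this]
    exact_mod_cast hs.ne'
  · have : dist (-z) z = 2 := by
      rw [dist_eq_norm, show -z - z = -(2 * z) by ring, norm_neg, norm_mul, hz1]; simp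
    rw [this]
    exact (min_le_right _ _).trans (by norm_num)

theorem halfSpaceIndex_eq_zero_of_notMem_essentialSpectrum {C : CellStructure H}
    (hW : W ∈ unitary (H →L[ℂ] H)) (hloc : IsEssentiallyLocal C W)
    {z : ℂ} (hz : z ∈ Metric.sphere (0 : ℂ) 1) (hzW : z ∉ essentialSpectrum W) :
    halfSpaceIndex C W = 0 := by
  obtain ⟨w, hw, hwW⟩ := exists_notMem_spectrum_of_notMem_essentialSpectrum hW hz hzW
  exact (isUnitAddCompact_compress_of_notMem_spectrum (E := C.halfSpace 0) hW
    (hloc.isCompactOperator_commutator hW 0) hw hwW).fredholmIndex_eq_zero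

end Spectrum

end QWalk

theorem mainTheorem9 {H : Type*} [NormedAddCommGroup H] [InnerProductSpace ℂ H] [CompleteSpace H]
    (C : QWalk.CellStructure H) (W : H →L[ℂ] H) (hW : W ∈ unitary (H →L[ℂ] H))
    (hloc : QWalk.IsEssentiallyLocal C W) :
    (QWalk.compression C W).IsFredholm ∧
      (QWalk.halfSpaceIndex C W ≠ 0 → QWalk.essentialSpectrum W = Metric.sphere (0 : ℂ) 1) ∧
      (QWalk.IsEssentiallyGapped W → QWalk.halfSpaceIndex C W = 0) := by
  refine ⟨QWalk.isFredholm_compress (E := C.halfSpace 0) hW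
    (hloc.isCompactOperator_commutator hW 0), fun hne => ?_, fun hgap => ?_⟩
  · refine (QWalk.essentialSpectrum_subset_sphere hW).antisymm fun z hz => ?_
    by_contra hzW
    exact hne (QWalk.halfSpaceIndex_eq_zero_of_notMem_essentialSpectrum hW hloc hz hzW)
  · exact QWalk.halfSpaceIndex_eq_zero_of_notMem_essentialSpectrum hW hloc (by simp) hgap.1
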